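/- A group $G$ is a \emph{2-group} if the order of every element of $G$ is a power of $2$. For an integer $n\ge 0$ let $C_{2^n}=\{z\in\mathbb C: z^{2^n}=1\}$, and let $C_{2^\infty}=\bigcup_{n\ge 1}C_{2^n}\subset\mathbb C$ be the quasicyclic 2-group. Regard $\mathbb C$ as a subalgebra of the real algebra $\mathbb H$ of quaternions in the standard way, and let $Q_8=\{1,-1,i,-i,j,-j,k,-k\}\subset\mathbb H$. For an integer $n\ge 1$ let $Q_{2^n}$ be the subgroup of the multiplicative group of $\mathbb H$ generated by $C_{2^{n-1}}\cup Q_8$, and let $Q_{2^\infty}=\bigcup_{n\ge 1}Q_{2^n}$. **Theorem.** Let $G$ be a 2-group, finite or infinite, that has exactly one subgroup of order $2$. Then there is $n\in\{1,2,3,\dots\}\cup\{\infty\}$ such that $G$ is isomorphic to $C_{2^n}$ or to $Q_{2^n}$; here $n=\infty$ if and only if $G$ is infinite. In particular, every infinite 2-group with exactly one subgroup of order $2$ is isomorphic to $C_{2^\infty}$ or to $Q_{2^\infty}$. -/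

import Mathlib

open scoped Quaternion

namespace TwoGroups

/-- The cyclic group `C_{2^n} = {z ∈ ℂ : z^(2^n) = 1}`, as a subgroup of `ℂˣ`. -/
def cyclicFin (n : ℕ) : Subgroup ℂˣ := rootsOfUnity (2 ^ n) ℂ

/-- The quasicyclic 2-group `C_{2^∞} = ⋃ n ≥ 1, C_{2^n}`, as a subgroup of `ℂˣ`.
The join is the set-theoretic union, see `coe_quasicyclic`. -/
def quasicyclic : Subgroup ℂˣ := ⨆ n : ℕ+, cyclicFin n

/-- `C_{2^n}` for `n ∈ ℕ ∪ {∞}`. -/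
def C : ℕ∞ → Subgroup ℂˣ
  | ⊤ => quasicyclic
  | (n : ℕ) => cyclicFin n

/-- The quaternion unit `i`. -/
def qi : ℍ[ℝ] := ⟨0, 1, 0, 0⟩

/-- The quaternion unit `j`. -/
def qj : ℍ[ℝ] := ⟨0, 0, 1, 0⟩

/-- The quaternion unit `k`. -/
def qk : ℍ[ℝ] := ⟨0, 0, 0, 1⟩

/-- The set `Q₈ = {1, -1, i, -i, j, -j, k, -k}` of units of the real quaternions. -/
def Q8 : Set ℍ[ℝ]ˣ :=
  {q | (q : ℍ[ℝ]) ∈ ({1, -1, qi, -qi, qj, -qj, qk, -qk} : Set ℍ[ℝ])}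

/-- The standard embedding `a + b i ↦ a + b i` of `ℂ` into `ℍ`, on units. -/
noncomputable def complexUnits : ℂˣ →* ℍ[ℝ]ˣ :=
  Units.map (Quaternion.ofComplex : ℂ →* ℍ[ℝ])

/-- The group `Q_{2^n}` of generalized quaternions, for `n ≥ 1`: the subgroup of `ℍˣ` generated by
`C_{2^(n-1)} ∪ Q₈`. -/
noncomputable def quaternionFin (n : ℕ) : Subgroup ℍ[ℝ]ˣ :=
  Subgroup.closure (complexUnits '' (cyclicFin (n - 1) : Set ℂˣ) ∪ Q8)

/-- The infinite group of generalized quaternions `Q_{2^∞} = ⋃ n ≥ 1, Q_{2^n}`, as a subgroup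
of `ℍˣ`. The join is the set-theoretic union, see `coe_quaternionInf`. -/
noncomputable def quaternionInf : Subgroup ℍ[ℝ]ˣ := ⨆ n : ℕ+, quaternionFin n

/-- `Q_{2^n}` for `n ∈ ℕ ∪ {∞}`. -/
noncomputable def Q : ℕ∞ → Subgroup ℍ[ℝ]ˣ
  | ⊤ => quaternionInf
  | (n : ℕ) => quaternionFin n

theorem C_top : C ⊤ = quasicyclic := rfl

theorem C_coe (n : ℕ) : C n = cyclicFin n := rfl

theorem Q_top : Q ⊤ = quaternionInf := rfl

theorem Q_coe (n : ℕ) : Q n = quaternionFin n := rfl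

theorem mem_cyclicFin (n : ℕ) (z : ℂˣ) : z ∈ cyclicFin n ↔ (z : ℂ) ^ 2 ^ n = 1 :=
  mem_rootsOfUnity' _ _

theorem cyclicFin_mono : Monotone cyclicFin :=
  fun _ _ h => rootsOfUnity_le_of_dvd (pow_dvd_pow 2 h)

theorem quaternionFin_mono : Monotone quaternionFin := fun _ _ h =>
  Subgroup.closure_mono (Set.union_subset_union_left _
    (Set.image_mono (cyclicFin_mono (Nat.sub_le_sub_right h 1))))

theorem coe_quasicyclic : (quasicyclic : Set ℂˣ) = ⋃ n : ℕ+, (cyclicFin n : Set ℂˣ) :=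
  Subgroup.coe_iSup_of_directed
    (Monotone.directed_le fun _ _ h => cyclicFin_mono (PNat.coe_le_coe _ _ |>.2 h))

theorem coe_quaternionInf :
    (quaternionInf : Set ℍ[ℝ]ˣ) = ⋃ n : ℕ+, (quaternionFin n : Set ℍ[ℝ]ˣ) :=
  Subgroup.coe_iSup_of_directed
    (Monotone.directed_le fun _ _ h => quaternionFin_mono (PNat.coe_le_coe _ _ |>.2 h))

end TwoGroups

/-!
Let `z` be the only involution of `G`; it is central, and every `g ≠ 1` has a power equal to `z`.
Call the solutions of `w ^ 2 = z` the elements of order four. Two commuting ones are equal or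
inverse to each other, and if `y` inverts one of them by conjugation, then `y` itself has order
four and inverts its whole centralizer.

If `G` is abelian, divisibility of `ℂˣ` gives a homomorphism to `ℂˣ` that does not kill `z`, hence
is injective, and the 2-subgroups of `ℂˣ` are the groups `C n`.

If `G` is not abelian, some `b` of order four generates a normal subgroup. When there is an element
`c` of order eight, `b = c ^ 2` works: the squares of two elements of order eight cannot generate
`Q₈`, since the product of these two elements would permute the three subgroups of order four in
`Q₈` cyclically, which an element of 2-power order cannot do. The centralizer `K` of `b` is then
abelian of index two and is inverted by every `y ∉ K`. Extend `b ↦ i` to an embedding of `K` in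
`ℂˣ`, and then to an embedding of `G` in `ℍˣ` with `y ↦ j`.
-/

namespace TwoGroups

section Group

variable {G : Type*} [Group G] {g h k y : G}

theorem semiconjBy_inv_iff_mul_sq : SemiconjBy g k k⁻¹ ↔ (g * k) ^ 2 = g ^ 2 := by
  rw [SemiconjBy, eq_inv_mul_iff_mul_eq, ← mul_right_inj g, pow_two, pow_two]
  simp only [mul_assoc]

theorem commute_of_semiconjBy_inv (hg : SemiconjBy y g g⁻¹) (hh : SemiconjBy y h h⁻¹)
    (hgh : SemiconjBy y (g * h) (g * h)⁻¹) : Commute g h := by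
  have hinv : (g * h)⁻¹ = g⁻¹ * h⁻¹ := mul_right_cancel (hgh.eq.symm.trans (hg.mul_right hh).eq)
  rw [← Commute.inv_inv_iff, commute_iff_eq, ← hinv, mul_inv_rev]

theorem commute_of_commute_pow_of_coprime {p n : ℕ} (hG : IsPGroup p G) (hn : p.Coprime n)
    (h : Commute (g ^ n) k) : Commute g k := by
  obtain ⟨m, hm⟩ := exists_pow_eq_self_of_coprime (hG.orderOf_coprime hn g).symm
  exact hm ▸ h.pow_left m

/-- `z` is the only element of order two of its group. -/
structure IsUniqueInvolution (z : G) : Prop where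
  ne_one : z ≠ 1
  sq_eq_one_iff {g : G} : g ^ 2 = 1 ↔ g = 1 ∨ g = z

theorem exists_isUniqueInvolution (hU : ∃! H : Subgroup G, Nat.card H = 2) :
    ∃ z : G, IsUniqueInvolution z := by
  obtain ⟨H, hH, huniq⟩ := hU
  obtain ⟨z, hz1, hz⟩ := (Nat.card_eq_two_iff' (1 : H)).1 hH
  have hmem {g : G} (hg : g ^ 2 = 1) (hg1 : g ≠ 1) : g ∈ H :=
    huniq _ ((Nat.card_zpowers g).trans (orderOf_eq_prime hg hg1)) ▸ Subgroup.mem_zpowers g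
  refine ⟨z, fun h => hz1 (Subtype.ext h), fun {g} => ⟨fun hg => ?_, ?_⟩⟩
  · exact or_iff_not_imp_left.2 fun hg1 =>
      congrArg Subtype.val (hz ⟨g, hmem hg hg1⟩ fun h => hg1 (congrArg Subtype.val h))
  · rintro (rfl | rfl)
    · exact one_pow 2
    · have hsq := pow_card_eq_one' (x := z)
      rw [hH] at hsq
      exact congrArg Subtype.val hsq

end Group

namespace IsUniqueInvolution

variable {G : Type*} [Group G] {z b c f g h k : G}

theorem sq_eq_one (hz : IsUniqueInvolution z) : z ^ 2 = 1 :=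
  hz.sq_eq_one_iff.2 (Or.inr rfl)

theorem subgroup (hz : IsUniqueInvolution z) {K : Subgroup G} (hzK : z ∈ K) :
    IsUniqueInvolution (⟨z, hzK⟩ : K) where
  ne_one h := hz.ne_one (congrArg Subtype.val h)
  sq_eq_one_iff {g} := by
    rw [Subtype.ext_iff, Subtype.ext_iff (a1 := g), Subtype.ext_iff (a1 := g)]
    exact hz.sq_eq_one_iff

theorem commute (hz : IsUniqueInvolution z) (g : G) : Commute g z := by
  have hconj : (g * z * g⁻¹) ^ 2 = 1 := by rw [conj_pow, hz.sq_eq_one, mul_one, mul_inv_cancel]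
  rcases hz.sq_eq_one_iff.1 hconj with h | h
  · exact absurd (conj_eq_one_iff.1 h) hz.ne_one
  · exact mul_inv_eq_iff_eq_mul.1 h

theorem commute_of_eq_one_or_eq (hz : IsUniqueInvolution z) (h : g = 1 ∨ g = z) (k : G) :
    Commute g k := by
  rcases h with rfl | rfl
  exacts [Commute.one_left k, (hz.commute k).symm]

theorem exists_pow_eq (hz : IsUniqueInvolution z) (hG : IsPGroup 2 G) (hg : g ≠ 1) :
    ∃ n : ℕ, g ^ 2 ^ n = z := by
  obtain ⟨n, hn⟩ := IsPGroup.iff_orderOf.1 hG g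
  cases n with
  | zero => exact absurd (orderOf_eq_one_iff.1 hn) hg
  | succ n =>
    have hsq : (g ^ 2 ^ n) ^ 2 = 1 := by rw [← pow_mul, ← pow_succ, ← hn, pow_orderOf_eq_one]
    have hne : g ^ 2 ^ n ≠ 1 := pow_ne_one_of_lt_orderOf (by positivity)
      (hn ▸ Nat.pow_lt_pow_succ one_lt_two)
    exact ⟨n, (hz.sq_eq_one_iff.1 hsq).resolve_left hne⟩

theorem exists_pow_sq_eq (hz : IsUniqueInvolution z) (hG : IsPGroup 2 G)
    (hg : ¬(g = 1 ∨ g = z)) : ∃ n : ℕ, (g ^ 2 ^ n) ^ 2 = z := by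
  obtain ⟨n, hn⟩ := hz.exists_pow_eq hG (mt hz.sq_eq_one_iff.1 hg)
  exact ⟨n, by rw [pow_right_comm, hn]⟩

theorem injective_of_map_ne_one {M : Type*} [Group M] (hz : IsUniqueInvolution z)
    (hG : IsPGroup 2 G) {φ : G →* M} (h : φ z ≠ 1) : Function.Injective φ := by
  refine (injective_iff_map_eq_one φ).2 fun g hg => by_contra fun hg1 => h ?_
  obtain ⟨n, hn⟩ := hz.exists_pow_eq hG hg1
  rw [← hn, map_pow, hg, one_pow]

theorem orderOf_eq_four (hz : IsUniqueInvolution z) (hb : b ^ 2 = z) : orderOf b = 4 :=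
  orderOf_eq_prime_pow (p := 2) (n := 1) (by simpa [hb] using hz.ne_one)
    (by rw [pow_succ, pow_one, pow_mul, hb, hz.sq_eq_one])

theorem eq_or_eq_inv_of_commute (hz : IsUniqueInvolution z) (hg : g ^ 2 = z) (hb : b ^ 2 = z)
    (hgb : Commute g b) : g = b ∨ g = b⁻¹ := by
  have hsq : (g * b) ^ 2 = 1 := by rw [hgb.mul_pow, hg, hb, ← pow_two, hz.sq_eq_one]
  rcases hz.sq_eq_one_iff.1 hsq with h | h
  · exact Or.inr (mul_eq_one_iff_eq_inv.1 h)
  · exact Or.inl (mul_right_cancel (h.trans (hb.symm.trans (pow_two b))))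

theorem not_commute_of_semiconjBy_inv (hz : IsUniqueInvolution z) (hb : b ^ 2 = z)
    (h : SemiconjBy g b b⁻¹) : ¬Commute g b := fun hgb => by
  have hinv : b = b⁻¹ := mul_right_cancel (hgb.eq.symm.trans h.eq)
  exact hz.ne_one (by rw [← hb, pow_two, mul_eq_one_iff_eq_inv, ← hinv])

theorem sq_eq_of_semiconjBy_inv (hz : IsUniqueInvolution z) (hG : IsPGroup 2 G) (hb : b ^ 2 = z)
    (h : SemiconjBy g b b⁻¹) : g ^ 2 = z := by
  have hgb := hz.not_commute_of_semiconjBy_inv hb h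
  obtain ⟨n, hn⟩ := hz.exists_pow_sq_eq hG fun hg => hgb (hz.commute_of_eq_one_or_eq hg b)
  cases n with
  | zero => simpa using hn
  | succ n =>
    have hgg : Commute (g ^ 2) b := by
      rw [pow_two]
      exact SemiconjBy.mul_left (by simpa using h.inv_right) h
    have hpow : Commute (g ^ 2 ^ (n + 1)) b := by
      rw [pow_succ', pow_mul]
      exact hgg.pow_left _
    refine absurd ?_ hgb
    rcases hz.eq_or_eq_inv_of_commute hn hb hpow with h | h
    · exact h ▸ Commute.self_pow g _
    · exact Commute.inv_right_iff.1 (h ▸ Commute.self_pow g _)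

theorem semiconjBy_inv_of_commute (hz : IsUniqueInvolution z) (hG : IsPGroup 2 G)
    (hb : b ^ 2 = z) (h : SemiconjBy g b b⁻¹) (hk : Commute k b) : SemiconjBy g k k⁻¹ := by
  rw [semiconjBy_inv_iff_mul_sq, hz.sq_eq_of_semiconjBy_inv hG hb h]
  exact hz.sq_eq_of_semiconjBy_inv hG hb (h.mul_left hk)

theorem eq_or_eq_mul_of_sq_eq (hz : IsUniqueInvolution z) (hG : IsPGroup 2 G) (hb : b ^ 2 = z)
    (hbc : ∀ g, Commute g b) (hgh : g ^ 2 = h ^ 2) : g = h ∨ g = z * h := by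
  have hinv : SemiconjBy g⁻¹ (g * h⁻¹) (g * h⁻¹)⁻¹ := by
    rw [semiconjBy_inv_iff_mul_sq, inv_mul_cancel_left, inv_pow, inv_pow, hgh]
  by_cases hz1 : g * h⁻¹ = 1 ∨ g * h⁻¹ = z
  · exact hz1.imp mul_inv_eq_one.1 mul_inv_eq_iff_eq_mul.1
  obtain ⟨n, hn⟩ := hz.exists_pow_sq_eq hG hz1
  have hpow := hinv.pow_right (2 ^ n)
  rw [inv_pow] at hpow
  refine absurd ?_ (hz.not_commute_of_semiconjBy_inv hn hpow)
  rcases hz.eq_or_eq_inv_of_commute hn hb (hbc _) with h | h <;> rw [h]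
  exacts [hbc _, (hbc _).inv_right]

theorem mem_zpowers_of_sq_mem (hz : IsUniqueInvolution z) (hG : IsPGroup 2 G) (hb : b ^ 2 = z)
    (hbc : ∀ g, Commute g b) (hg : g ≠ 1) (h : k ^ 2 ∈ Subgroup.zpowers (g ^ 2)) :
    k ∈ Subgroup.zpowers g := by
  obtain ⟨i, hi⟩ := h
  have hsq : k ^ 2 = (g ^ i) ^ 2 := by
    simp only [← hi, pow_two, (Commute.refl g).mul_zpow]
  obtain ⟨n, hn⟩ := hz.exists_pow_eq hG hg
  rcases hz.eq_or_eq_mul_of_sq_eq hG hb hbc hsq with rfl | rfl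
  · exact Subgroup.zpow_mem_zpowers g i
  · exact mul_mem (hn ▸ Subgroup.npow_mem_zpowers g _) (Subgroup.zpow_mem_zpowers g i)

theorem mem_zpowers_or_mem_zpowers (hz : IsUniqueInvolution z) (hG : IsPGroup 2 G)
    (hb : b ^ 2 = z) (hbc : ∀ g, Commute g b) (g h : G) :
    g ∈ Subgroup.zpowers h ∨ h ∈ Subgroup.zpowers g := by
  obtain ⟨n, hn⟩ := hG g
  induction n generalizing g h with
  | zero => exact Or.inl (by simp_all)
  | succ n ih =>
    by_cases hg : g = 1
    · exact Or.inl (hg ▸ one_mem _)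
    by_cases hh : h = 1
    · exact Or.inr (hh ▸ one_mem _)
    exact (ih (g ^ 2) (h ^ 2) (by rw [← pow_mul, ← pow_succ', hn])).imp
      (hz.mem_zpowers_of_sq_mem hG hb hbc hh) (hz.mem_zpowers_of_sq_mem hG hb hbc hg)

theorem commute_of_forall_commute (hz : IsUniqueInvolution z) (hG : IsPGroup 2 G)
    (hb : b ^ 2 = z) (hbc : ∀ g, Commute g b) (g h : G) : Commute g h := by
  rcases hz.mem_zpowers_or_mem_zpowers hG hb hbc g h with ⟨i, rfl⟩ | ⟨i, rfl⟩
  exacts [Commute.zpow_self h i, Commute.self_zpow g i]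

theorem semiconjBy_inv_symm (hz : IsUniqueInvolution z) (hG : IsPGroup 2 G) (hb : b ^ 2 = z)
    (h : SemiconjBy g b b⁻¹) : SemiconjBy b g g⁻¹ := by
  have h' : SemiconjBy (b * g) b b⁻¹ :=
    SemiconjBy.mul_left (Commute.refl b).inv_right h
  rw [semiconjBy_inv_iff_mul_sq, hb, hz.sq_eq_of_semiconjBy_inv hG hb h']

theorem not_semiconjBy_sq_sq_inv (hz : IsUniqueInvolution z) (hG : IsPGroup 2 G)
    (hc : (c ^ 2) ^ 2 = z) (hf : (f ^ 2) ^ 2 = z) :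
    ¬SemiconjBy (c ^ 2) (f ^ 2) (f ^ 2)⁻¹ := fun hcf => by
  have hfc : SemiconjBy (f ^ 2) (c ^ 2) (c ^ 2)⁻¹ := hz.semiconjBy_inv_symm hG hf hcf
  have conj_sq {u v : G} (h : SemiconjBy (v ^ 2) u u⁻¹) :
      SemiconjBy u (v ^ 2) (u ^ 2 * v ^ 2) := by
    rw [SemiconjBy, mul_assoc, h.eq, pow_two u, ← mul_assoc, mul_inv_cancel_right]
  have hc_e : SemiconjBy c (f ^ 2) (c ^ 2 * f ^ 2) :=
    conj_sq (hz.semiconjBy_inv_of_commute hG hc hfc (Commute.self_pow c 2))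
  have hf_b : SemiconjBy f (c ^ 2) (f ^ 2 * c ^ 2) :=
    conj_sq (hz.semiconjBy_inv_of_commute hG hf hcf (Commute.self_pow f 2))
  have hc_b : Commute c (c ^ 2) := Commute.self_pow c 2
  have hf_e : Commute f (f ^ 2) := Commute.self_pow f 2
  generalize c ^ 2 = b, f ^ 2 = e at *
  have hbeb : b * e * b = e := by rw [mul_assoc, hfc.eq, mul_inv_cancel_left]
  have hebe : e * b * e = b := by rw [mul_assoc, hcf.eq, mul_inv_cancel_left]
  have cycle₁ : SemiconjBy (c * f) b e := by
    simpa only [hbeb] using (hc_e.mul_right hc_b).mul_left hf_b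
  have cycle₂ : SemiconjBy (c * f) e (b * e) := hc_e.mul_left hf_e
  have cycle₃ : SemiconjBy (c * f) (b * e) b := by
    simpa only [← mul_assoc, hebe] using cycle₁.mul_right cycle₂
  have hpow : Commute ((c * f) ^ 3) b := by
    rw [pow_succ, pow_two]
    exact (cycle₃.mul_left cycle₂).mul_left cycle₁
  have hcomm : Commute (c * f) b := commute_of_commute_pow_of_coprime hG (by norm_num) hpow
  have hbe : b = e := mul_right_cancel (hcomm.eq.symm.trans cycle₁.eq)
  exact hz.not_commute_of_semiconjBy_inv hf hcf (hbe ▸ Commute.refl _)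

theorem sq_eq_or_eq_inv_of_sq_sq_eq (hz : IsUniqueInvolution z) (hG : IsPGroup 2 G)
    (hc : (c ^ 2) ^ 2 = z) (hf : (f ^ 2) ^ 2 = z) : f ^ 2 = c ^ 2 ∨ f ^ 2 = (c ^ 2)⁻¹ := by
  by_cases hd : c ^ 2 * f ^ 2 = 1 ∨ c ^ 2 * f ^ 2 = z
  · refine hd.symm.imp (fun h => ?_) fun h => (inv_eq_of_mul_eq_one_right h).symm
    exact mul_left_cancel (h.trans (hc.symm.trans (pow_two _)))
  exfalso
  have hinv : SemiconjBy (c ^ 2) (c ^ 2 * f ^ 2) (c ^ 2 * f ^ 2)⁻¹ := by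
    rw [semiconjBy_inv_iff_mul_sq, ← mul_assoc, ← pow_two (c ^ 2), hc,
      (hz.commute _).symm.mul_pow, hz.sq_eq_one, hf, one_mul]
  obtain ⟨n, hn⟩ := hz.exists_pow_sq_eq hG hd
  cases n with
  | zero =>
    rw [pow_zero, pow_one] at hn
    exact hz.not_semiconjBy_sq_sq_inv hG hc hf
      (semiconjBy_inv_iff_mul_sq.2 (hn.trans hc.symm))
  | succ n =>
    rw [pow_succ 2, pow_mul] at hn
    refine hz.not_semiconjBy_sq_sq_inv hG hc hn ?_
    have hpow := hinv.pow_right (2 ^ n * 2)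
    rwa [inv_pow, pow_mul] at hpow

theorem exists_forall_commute_or_semiconjBy_inv (hz : IsUniqueInvolution z) (hG : IsPGroup 2 G)
    (h4 : ∃ b : G, b ^ 2 = z) :
    ∃ b : G, b ^ 2 = z ∧ ∀ g, Commute g b ∨ SemiconjBy g b b⁻¹ := by
  by_cases h8 : ∃ c : G, (c ^ 2) ^ 2 = z
  · obtain ⟨c, hc⟩ := h8
    refine ⟨c ^ 2, hc, fun g => ?_⟩
    have hconj : ((g * c * g⁻¹) ^ 2) ^ 2 = z := by
      rw [conj_pow, conj_pow, hc, (hz.commute g).eq, mul_inv_cancel_right]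
    have hg : SemiconjBy g (c ^ 2) ((g * c * g⁻¹) ^ 2) := (SemiconjBy.conj_mk g c).pow_right 2
    rcases hz.sq_eq_or_eq_inv_of_sq_sq_eq hG hc hconj with h | h <;> rw [h] at hg
    exacts [Or.inl hg, Or.inr hg]
  · have hsq {g k : G} (hgk : ¬Commute g k) : g ^ 2 = z := by
      obtain ⟨n, hn⟩ := hz.exists_pow_sq_eq hG fun hg => hgk (hz.commute_of_eq_one_or_eq hg k)
      cases n with
      | zero => simpa using hn
      | succ n => exact absurd ⟨g ^ 2 ^ n, by rw [← pow_mul g, ← pow_succ, hn]⟩ h8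
    obtain ⟨b, hb⟩ := h4
    refine ⟨b, hb, fun g => or_iff_not_imp_left.2 fun hgb => ?_⟩
    have hgbb : ¬Commute (g * b) b := fun h =>
      hgb (by simpa using h.mul_left (Commute.refl b).inv_left)
    exact semiconjBy_inv_iff_mul_sq.2 ((hsq hgbb).trans (hsq hgb).symm)

end IsUniqueInvolution

/-- `G` is the generalized dicyclic group `Dic(K, z)`, generated by a subgroup `K` of index two and
an element `y` with `y ^ 2 = z` that inverts `K` by conjugation; `K` is then abelian. -/
structure IsGeneralizedDicyclic {G : Type*} [Group G] (z : G) (K : Subgroup G) (y : G) : Prop where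
  index_eq_two : K.index = 2
  notMem : y ∉ K
  sq_eq : y ^ 2 = z
  semiconjBy_inv {k : G} : k ∈ K → SemiconjBy y k k⁻¹

theorem IsGeneralizedDicyclic.mem {G : Type*} [Group G] {z y : G} {K : Subgroup G}
    (h : IsGeneralizedDicyclic z K y) : z ∈ K :=
  h.sq_eq ▸ Subgroup.sq_mem_of_index_two h.index_eq_two y

theorem IsGeneralizedDicyclic.isMulCommutative {G : Type*} [Group G] {z y : G} {K : Subgroup G}
    (h : IsGeneralizedDicyclic z K y) : IsMulCommutative K where
  is_comm.comm k l := Subtype.ext <| commute_of_semiconjBy_inv (h.semiconjBy_inv k.2)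
    (h.semiconjBy_inv l.2) (h.semiconjBy_inv (mul_mem k.2 l.2))

theorem IsUniqueInvolution.exists_isGeneralizedDicyclic {G : Type*} [Group G] {z : G}
    (hz : IsUniqueInvolution z) (hG : IsPGroup 2 G) (hcomm : ¬IsMulCommutative G) :
    ∃ (K : Subgroup G) (y : G), IsGeneralizedDicyclic z K y ∧ ∃ b ∈ K, b ^ 2 = z := by
  have h4 : ∃ b : G, b ^ 2 = z := by
    obtain ⟨g, h, hgh⟩ : ∃ g h : G, ¬Commute g h := by
      by_contra! hall
      exact hcomm ⟨⟨hall⟩⟩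
    obtain ⟨n, hn⟩ := hz.exists_pow_sq_eq hG fun hg => hgh (hz.commute_of_eq_one_or_eq hg h)
    exact ⟨g ^ 2 ^ n, hn⟩
  obtain ⟨b, hb, hnormal⟩ := hz.exists_forall_commute_or_semiconjBy_inv hG h4
  obtain ⟨y, hy⟩ : ∃ y, SemiconjBy y b b⁻¹ := by
    by_contra! hcentral
    have hbc (g : G) : Commute g b := (hnormal g).resolve_right (hcentral g)
    exact hcomm ⟨⟨hz.commute_of_forall_commute hG hb hbc⟩⟩
  have mem_centralizer {g : G} : g ∈ Subgroup.centralizer {b} ↔ Commute g b := by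
    rw [Subgroup.mem_centralizer_singleton_iff, commute_iff_eq, eq_comm]
  have hyb : y ∉ Subgroup.centralizer {b} :=
    mt mem_centralizer.1 (hz.not_commute_of_semiconjBy_inv hb hy)
  refine ⟨Subgroup.centralizer {b}, y, ⟨?_, hyb, hz.sq_eq_of_semiconjBy_inv hG hb hy, fun hk =>
    hz.semiconjBy_inv_of_commute hG hb hy (mem_centralizer.1 hk)⟩, b,
    mem_centralizer.2 (Commute.refl b), hb⟩
  refine Subgroup.index_eq_two_iff_exists_notMem_and.2 ⟨y, hyb, fun g => ?_⟩
  simp only [mem_centralizer]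
  refine (hnormal g).symm.imp_left fun hg => ?_
  exact (inv_inv b ▸ hg.inv_right).mul_left hy

section IndexTwo

variable {G M : Type*} [Group G] {K : Subgroup G} {y : G}

theorem inv_mul_mem_of_index_eq_two (hK : K.index = 2) (hy : y ∉ K) {g : G} (hg : g ∉ K) :
    y⁻¹ * g ∈ K := by
  simpa [Subgroup.mul_mem_iff_of_index_two hK, hy] using hg

theorem exists_eq_or_eq_mul_of_index_eq_two (hK : K.index = 2) (hy : y ∉ K) (g : G) :
    ∃ k : K, g = k ∨ g = y * k := by
  by_cases hg : g ∈ K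
  · exact ⟨⟨g, hg⟩, Or.inl rfl⟩
  · exact ⟨⟨_, inv_mul_mem_of_index_eq_two hK hy hg⟩, Or.inr (mul_inv_cancel_left y g).symm⟩

theorem sup_zpowers_eq_top_of_index_eq_two (hK : K.index = 2) (hy : y ∉ K) :
    K ⊔ Subgroup.zpowers y = ⊤ := by
  refine eq_top_iff.2 fun g _ => ?_
  have hle {k : K} : (k : G) ∈ K ⊔ Subgroup.zpowers y := Subgroup.mem_sup_left k.2
  obtain ⟨k, rfl | rfl⟩ := exists_eq_or_eq_mul_of_index_eq_two hK hy g
  exacts [hle, mul_mem (Subgroup.mem_sup_right (Subgroup.mem_zpowers y)) hle]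

theorem exists_monoidHom_extension_of_index_eq_two [Monoid M] (hK : K.index = 2) (hy : y ∉ K)
    (ψ : K →* M) (j : M) (hj : j * j = ψ ⟨y * y, Subgroup.mul_self_mem_of_index_two hK y⟩)
    (hψ : ∀ k l : K, SemiconjBy y (k : G) l → SemiconjBy j (ψ k) (ψ l)) :
    ∃ Φ : G →* M, Φ.comp K.subtype = ψ ∧ Φ y = j := by
  classical
  let f (g : G) : M :=
    if h : g ∈ K then ψ ⟨g, h⟩ else j * ψ ⟨y⁻¹ * g, inv_mul_mem_of_index_eq_two hK hy h⟩
  have f_coe (k : K) : f k = ψ k := by simp [f]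
  have f_mul (k : K) : f (y * k) = j * ψ k := by
    have hyk : y * (k : G) ∉ K := by rwa [Subgroup.mul_mem_cancel_right K k.2]
    simp [f, hyk]
  have conj_mem (k : K) : ∃ l : K, SemiconjBy y (l : G) k := by
    have := Subgroup.normal_of_index_eq_two hK
    exact ⟨⟨y⁻¹ * k * y, by simpa using this.conj_mem k k.2 y⁻¹⟩, by simp [SemiconjBy, mul_assoc]⟩
  refine ⟨⟨⟨f, by simpa using f_coe 1⟩, fun g h => ?_⟩, MonoidHom.ext f_coe, ?_⟩
  · change f (g * h) = f g * f h
    obtain ⟨k, rfl | rfl⟩ := exists_eq_or_eq_mul_of_index_eq_two hK hy g <;>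
      obtain ⟨l, rfl | rfl⟩ := exists_eq_or_eq_mul_of_index_eq_two hK hy h
    · rw [f_coe, f_coe, ← Subgroup.coe_mul, f_coe, map_mul]
    · obtain ⟨m, hm⟩ := conj_mem k
      rw [← mul_assoc, ← hm.eq, mul_assoc, ← Subgroup.coe_mul, f_mul, f_mul, f_coe, map_mul,
        ← mul_assoc, (hψ m k hm).eq, mul_assoc]
    · rw [mul_assoc, ← Subgroup.coe_mul, f_mul, f_mul, f_coe, map_mul, mul_assoc]
    · obtain ⟨m, hm⟩ := conj_mem k
      have hprod : y * (k : G) * (y * l) =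
          ((⟨y * y, Subgroup.mul_self_mem_of_index_two hK y⟩ * (m * l) : K) : G) := by
        rw [mul_assoc, ← mul_assoc (k : G), ← hm.eq]
        simp only [Subgroup.coe_mul, mul_assoc]
      rw [hprod, f_coe, f_mul, f_mul, map_mul, map_mul, ← hj, mul_assoc j (ψ k),
        ← mul_assoc (ψ k), ← (hψ m k hm).eq]
      simp only [mul_assoc]
  · simpa using f_mul 1

end IndexTwo

theorem exists_monoidHom_extension_of_rootableBy {A D : Type*} [CommGroup A] [CommGroup D]
    [RootableBy D ℕ] {S : Subgroup A} (f : S →* D) : ∃ φ : A →* D, φ.comp S.subtype = f := by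
  let _ : DivisibleBy (Additive D) ℕ :=
    { div d n := Additive.ofMul (RootableBy.root d.toMul n)
      div_zero d := RootableBy.root_zero d.toMul
      div_cancel {n} d hn := RootableBy.root_cancel (n := n) d.toMul hn }
  let _ := AddGroup.divisibleByIntOfDivisibleByNat (Additive D)
  obtain ⟨φ, hφ⟩ := (Module.Baer.of_divisible (Additive D)).extension_property_addMonoidHom
    S.subtype.toAdditive S.subtype_injective f.toAdditive
  exact ⟨MonoidHom.toAdditive.symm φ, MonoidHom.toAdditive.injective hφ⟩

theorem exists_monoidHom_apply_eq_of_orderOf_dvd {A D : Type*} [CommGroup A] [CommGroup D]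
    [RootableBy D ℕ] {a : A} {d : D} (h : orderOf d ∣ orderOf a) : ∃ φ : A →* D, φ a = d := by
  let a' : Subgroup.zpowers a := ⟨a, Subgroup.mem_zpowers a⟩
  have hgen (x : Subgroup.zpowers a) : x ∈ Subgroup.zpowers a' :=
    Subgroup.mem_zpowers_iff.2 ((Subgroup.mem_zpowers_iff.1 x.2).imp fun _ => Subtype.ext)
  have ha' : orderOf d ∣ orderOf a' := by rwa [← Subgroup.orderOf_coe]
  obtain ⟨φ, hφ⟩ := exists_monoidHom_extension_of_rootableBy (monoidHomOfForallMemZpowers hgen ha')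
  exact ⟨φ, (DFunLike.congr_fun hφ a').trans (monoidHomOfForallMemZpowers_apply_gen hgen ha')⟩

noncomputable instance {k : Type*} [Field k] [IsAlgClosed k] : RootableBy kˣ ℕ :=
  rootableByOfPowLeftSurj _ _ fun {n} hn x => by
    obtain ⟨w, hw⟩ := IsAlgClosed.exists_pow_nat_eq (x : k) (Nat.pos_of_ne_zero hn)
    have hw0 : w ≠ 0 := fun hw0 => x.ne_zero (by rw [← hw, hw0, zero_pow hn])
    exact ⟨Units.mk0 w hw0, Units.ext hw⟩

theorem mem_quasicyclic {x : ℂˣ} : x ∈ quasicyclic ↔ ∃ k : ℕ, x ^ 2 ^ k = 1 := by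
  rw [← SetLike.mem_coe, coe_quasicyclic, Set.mem_iUnion]
  exact ⟨fun ⟨k, hk⟩ => ⟨k, hk⟩, fun ⟨k, hk⟩ => ⟨k.succPNat, cyclicFin_mono (Nat.le_succ k) hk⟩⟩

theorem zpowers_eq_cyclicFin {x : ℂˣ} {k : ℕ} (hx : orderOf x = 2 ^ k) :
    Subgroup.zpowers x = cyclicFin k :=
  (hx ▸ IsPrimitiveRoot.orderOf x).zpowers_eq

theorem exists_eq_C {S : Subgroup ℂˣ} (hS : IsPGroup 2 S) : ∃ n : ℕ∞, S = C n := by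
  by_cases h : ∀ n, cyclicFin n ≤ S
  · refine ⟨⊤, le_antisymm (fun x hx => mem_quasicyclic.2 ?_) (iSup_le fun n => h n)⟩
    exact (hS ⟨x, hx⟩).imp fun _ hk => congrArg Subtype.val hk
  · obtain ⟨m, hm, hm1⟩ : ∃ m, cyclicFin m ≤ S ∧ ¬cyclicFin (m + 1) ≤ S := by
      by_contra! hstep
      exact h fun n => Nat.rec (by simp [cyclicFin]) hstep n
    refine ⟨m, le_antisymm (fun x hx => ?_) hm⟩
    obtain ⟨k, hk⟩ := IsPGroup.iff_orderOf.1 hS ⟨x, hx⟩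
    rw [Subgroup.orderOf_mk] at hk
    have hkm : k ≤ m := by
      by_contra! hmk
      refine hm1 ((cyclicFin_mono hmk).trans ?_)
      rw [← zpowers_eq_cyclicFin hk]
      exact Subgroup.zpowers_le.2 hx
    exact cyclicFin_mono hkm (zpowers_eq_cyclicFin hk ▸ Subgroup.mem_zpowers x)

theorem infinite_C_iff {n : ℕ∞} : Infinite (C n) ↔ n = ⊤ := by
  constructor
  · intro h
    by_contra hn
    lift n to ℕ using hn
    exact h.not_finite (inferInstanceAs (Finite (rootsOfUnity (2 ^ n) ℂ)))
  · rintro rfl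
    by_contra h
    rw [not_infinite_iff_finite] at h
    have hle (n : ℕ) : 2 ^ n ≤ Nat.card (C ⊤) := by
      rw [← Complex.card_rootsOfUnity (2 ^ n)]
      exact Subgroup.card_le_of_le fun x hx => mem_quasicyclic.2 ⟨n, hx⟩
    exact (hle (Nat.card (C ⊤))).not_gt Nat.lt_two_pow_self

theorem one_le_of_nontrivial_C {n : ℕ∞} [Nontrivial (C n)] : 1 ≤ n := by
  rw [Order.one_le_iff_ne_zero]
  rintro rfl
  exact (Subgroup.nontrivial_iff_ne_bot (cyclicFin 0)).1 ‹_› (by simp [cyclicFin])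

theorem Q_add_one (n : ℕ∞) :
    Q (n + 1) = Subgroup.closure (complexUnits '' (C n : Set ℂˣ) ∪ Q8) := by
  induction n using ENat.recTopCoe with
  | top =>
    rw [top_add, C_top, Q_top, coe_quasicyclic, quaternionInf, Set.image_iUnion, Set.iUnion_union,
      Subgroup.closure_iUnion]
    refine le_antisymm (iSup_le fun n => ?_) (iSup_le fun n => ?_)
    · exact le_iSup_of_le n (Subgroup.closure_mono (Set.union_subset_union_left _
        (Set.image_mono (cyclicFin_mono (Nat.sub_le _ _)))))
    · exact le_iSup_of_le (n + 1) (Subgroup.closure_mono (Set.union_subset_union_left _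
        (Set.image_mono (cyclicFin_mono (by simp)))))
  | coe n => exact Q_coe (n + 1)

/-- The complex unit `i`. -/
noncomputable def unitI : ℂˣ := Units.mk0 Complex.I Complex.I_ne_zero

/-- The quaternion unit `j`, as an element of `ℍˣ`. -/
def unitJ : ℍ[ℝ]ˣ where
  val := qj
  inv := -qj
  val_inv := by ext <;> simp <;> simp [qj]
  inv_val := by ext <;> simp <;> simp [qj]

theorem val_complexUnits (w : ℂˣ) : (complexUnits w : ℍ[ℝ]) = ((w : ℂ) : ℍ[ℝ]) :=
  rfl

theorem complexUnits_injective : Function.Injective complexUnits :=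
  Units.map_injective (Quaternion.ofComplex : ℂ →+* ℍ[ℝ]).injective

theorem complexUnits_neg_one : complexUnits (-1) = -1 := by
  ext <;> simp [val_complexUnits]

theorem unitI_sq : unitI ^ 2 = -1 :=
  Units.ext (by simp [unitI])

theorem neg_one_ne_one : (-1 : ℂˣ) ≠ 1 :=
  Units.val_injective.ne_iff.1 (by norm_num)

theorem val_complexUnits_unitI : (complexUnits unitI : ℍ[ℝ]) = qi := by
  ext <;> simp [unitI, val_complexUnits] <;> simp [qi]

theorem unitJ_mul_self : unitJ * unitJ = -1 := by
  ext <;> simp [unitJ] <;> simp [qj]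

theorem qi_mul_qj : qi * qj = qk := by
  ext <;> simp <;> simp [qi, qj, qk]

theorem mem_Q8_iff {q : ℍ[ℝ]ˣ} :
    q ∈ Q8 ↔ ∃ u ∈ ({1, complexUnits unitI, unitJ, complexUnits unitI * unitJ} : Set ℍ[ℝ]ˣ),
      q = u ∨ q = -u := by
  have hJ : (unitJ : ℍ[ℝ]) = qj := rfl
  simp only [Set.mem_insert_iff, Set.mem_singleton_iff, exists_eq_or_imp, exists_eq_left, or_assoc]
  simp only [Q8, Set.mem_ofPred_eq, Set.mem_insert_iff, Set.mem_singleton_iff,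
    Units.ext_iff, Units.val_neg, Units.val_one, Units.val_mul, val_complexUnits_unitI,
    hJ, qi_mul_qj]

theorem semiconjBy_unitJ_complexUnits {w : ℂˣ} (hw : ‖(w : ℂ)‖ = 1) :
    SemiconjBy unitJ (complexUnits w) (complexUnits w)⁻¹ := by
  have hinv : ((w⁻¹ : ℂˣ) : ℂ) = starRingEnd ℂ w := by
    rw [Units.val_inv_eq_inv_val, Complex.inv_eq_conj hw]
  rw [← map_inv, SemiconjBy, Units.ext_iff, Units.val_mul, Units.val_mul, val_complexUnits,
    val_complexUnits, hinv]
  ext <;> simp [unitJ] <;> simp [qj]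

theorem closure_complexUnits_image_union_Q8 {S : Subgroup ℂˣ} (hI : unitI ∈ S) :
    Subgroup.closure (complexUnits '' S ∪ Q8) = S.map complexUnits ⊔ Subgroup.zpowers unitJ := by
  rw [Subgroup.closure_union, ← Subgroup.coe_map, Subgroup.closure_eq]
  refine le_antisymm (sup_le le_sup_left ((Subgroup.closure_le _).2 fun q hq => ?_))
    (sup_le_sup_left (Subgroup.zpowers_le.2 (Subgroup.subset_closure (mem_Q8_iff.2 ⟨unitJ, ?_⟩))) _)
  · set H := S.map complexUnits ⊔ Subgroup.zpowers unitJ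
    have hJ : unitJ ∈ H := Subgroup.mem_sup_right (Subgroup.mem_zpowers unitJ)
    have hS {w : ℂˣ} (hw : w ∈ S) : complexUnits w ∈ H :=
      Subgroup.mem_sup_left (Subgroup.mem_map_of_mem _ hw)
    have hneg {u : ℍ[ℝ]ˣ} (hu : u ∈ H) : -u ∈ H := by
      rw [← neg_one_mul, ← complexUnits_neg_one, ← unitI_sq]
      exact mul_mem (hS (pow_mem hI 2)) hu
    obtain ⟨u, hu, hqu⟩ := mem_Q8_iff.1 hq
    have huH : u ∈ H := by
      rcases hu with rfl | rfl | rfl | rfl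
      exacts [one_mem H, hS hI, hJ, mul_mem (hS hI) hJ]
    rcases hqu with rfl | rfl
    exacts [huH, hneg huH]
  · simp

theorem exists_range_eq_C {A : Type*} [Group A] (hA : IsPGroup 2 A) (φ : A →* ℂˣ) :
    ∃ n : ℕ∞, φ.range = C n :=
  exists_eq_C (hA.of_surjective φ.rangeRestrict φ.rangeRestrict_surjective)

theorem infinite_iff_of_range_eq_C {A : Type*} [Group A] {φ : A →* ℂˣ} {n : ℕ∞}
    (hφ : Function.Injective φ) (hn : φ.range = C n) : Infinite A ↔ n = ⊤ := by
  rw [← infinite_C_iff, ← hn]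
  exact (MonoidHom.ofInjective hφ).toEquiv.infinite_iff

namespace IsUniqueInvolution

open scoped IsMulCommutative

variable {A : Type*} [Group A] [IsMulCommutative A] {z b : A}

theorem exists_mulEquiv_C (hz : IsUniqueInvolution z) (hA : IsPGroup 2 A) :
    ∃ n : ℕ∞, 1 ≤ n ∧ (n = ⊤ ↔ Infinite A) ∧ Nonempty (A ≃* C n) := by
  have horder : orderOf (-1 : ℂˣ) ∣ orderOf z := by
    rw [orderOf_eq_prime hz.sq_eq_one hz.ne_one]
    exact orderOf_dvd_of_pow_eq_one (by simp)
  obtain ⟨φ, hφz⟩ := exists_monoidHom_apply_eq_of_orderOf_dvd horder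
  have hφ : Function.Injective φ := hz.injective_of_map_ne_one hA (hφz ▸ neg_one_ne_one)
  obtain ⟨n, hn⟩ := exists_range_eq_C hA φ
  let e : A ≃* C n := (MonoidHom.ofInjective hφ).trans (MulEquiv.subgroupCongr hn)
  have : Nontrivial A := ⟨z, 1, hz.ne_one⟩
  have : Nontrivial (C n) := e.toEquiv.nontrivial_congr.1 this
  exact ⟨n, one_le_of_nontrivial_C, (infinite_iff_of_range_eq_C hφ hn).symm, ⟨e⟩⟩

theorem exists_injective_apply_eq_unitI (hz : IsUniqueInvolution z) (hA : IsPGroup 2 A)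
    (hb : b ^ 2 = z) : ∃ φ : A →* ℂˣ, Function.Injective φ ∧ φ b = unitI := by
  have horder : orderOf unitI ∣ orderOf b := by
    rw [hz.orderOf_eq_four hb]
    exact orderOf_dvd_of_pow_eq_one (by rw [pow_mul unitI 2 2, unitI_sq, neg_one_sq])
  obtain ⟨φ, hφb⟩ := exists_monoidHom_apply_eq_of_orderOf_dvd horder
  refine ⟨φ, hz.injective_of_map_ne_one hA ?_, hφb⟩
  rw [← hb, map_pow, hφb, unitI_sq]
  exact neg_one_ne_one

end IsUniqueInvolution

namespace IsGeneralizedDicyclic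

variable {G : Type*} [Group G] {z y b : G} {K : Subgroup G}

theorem infinite_subgroup_iff (h : IsGeneralizedDicyclic z K y) : Infinite K ↔ Infinite G := by
  have : K.FiniteIndex := ⟨by rw [h.index_eq_two]; exact two_ne_zero⟩
  simp only [← not_finite_iff_infinite, Subgroup.finite_iff_finite_and_finiteIndex K, this,
    and_true]

theorem exists_extension (h : IsGeneralizedDicyclic z K y) (φ : K →* ℂˣ)
    (hφ : ∀ k, ‖(φ k : ℂ)‖ = 1) (hφz : φ ⟨z, h.mem⟩ = -1) :
    ∃ Φ : G →* ℍ[ℝ]ˣ, Φ.comp K.subtype = complexUnits.comp φ ∧ Φ y = unitJ := by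
  refine exists_monoidHom_extension_of_index_eq_two h.index_eq_two h.notMem _ _ ?_
    fun k l hkl => ?_
  · have hyz : (⟨y * y, Subgroup.mul_self_mem_of_index_two h.index_eq_two y⟩ : K) = ⟨z, h.mem⟩ :=
      Subtype.ext ((pow_two y).symm.trans h.sq_eq)
    rw [hyz, MonoidHom.comp_apply, hφz, complexUnits_neg_one, unitJ_mul_self]
  · have hl : l = k⁻¹ := Subtype.ext
      (mul_right_cancel (hkl.eq.symm.trans (h.semiconjBy_inv k.2).eq))
    rw [hl, map_inv]
    exact semiconjBy_unitJ_complexUnits (hφ k)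

theorem range_eq_Q (h : IsGeneralizedDicyclic z K y) {φ : K →* ℂˣ} (hI : unitI ∈ φ.range) {n : ℕ∞}
    (hn : φ.range = C n) {Φ : G →* ℍ[ℝ]ˣ} (hΦ : Φ.comp K.subtype = complexUnits.comp φ)
    (hΦy : Φ y = unitJ) : Φ.range = Q (n + 1) := by
  have hK : K.map Φ = (C n).map complexUnits := by
    rw [← hn, ← MonoidHom.range_comp, ← hΦ, MonoidHom.range_comp, K.range_subtype]
  rw [Q_add_one, closure_complexUnits_image_union_Q8 (hn ▸ hI), MonoidHom.range_eq_map,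
    ← sup_zpowers_eq_top_of_index_eq_two h.index_eq_two h.notMem, Subgroup.map_sup, hK,
    MonoidHom.map_zpowers, hΦy]

theorem exists_mulEquiv_Q (h : IsGeneralizedDicyclic z K y) (hz : IsUniqueInvolution z)
    (hG : IsPGroup 2 G) (hbK : b ∈ K) (hb : b ^ 2 = z) :
    ∃ n : ℕ∞, 1 ≤ n ∧ (n = ⊤ ↔ Infinite G) ∧ Nonempty (G ≃* Q n) := by
  have hK : IsPGroup 2 K := hG.to_subgroup K
  have := h.isMulCommutative
  have hbz : (⟨b, hbK⟩ : K) ^ 2 = ⟨z, h.mem⟩ := Subtype.ext hb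
  obtain ⟨φ, hφ, hφb⟩ := (hz.subgroup h.mem).exists_injective_apply_eq_unitI hK hbz
  have hφz : φ ⟨z, h.mem⟩ = -1 := by rw [← hbz, map_pow, hφb, unitI_sq]
  have hnorm (k : K) : ‖(φ k : ℂ)‖ = 1 := by
    obtain ⟨m, hm⟩ := hK k
    refine Complex.norm_eq_one_of_pow_eq_one (n := 2 ^ m) ?_ (by positivity)
    rw [← Units.val_pow_eq_pow_val, ← map_pow, hm, map_one, Units.val_one]
  obtain ⟨Φ, hΦ, hΦy⟩ := h.exists_extension φ hnorm hφz
  have hΦz : Φ z ≠ 1 := by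
    rw [show Φ z = complexUnits (-1) from hφz ▸ DFunLike.congr_fun hΦ ⟨z, h.mem⟩,
      ← map_one complexUnits, complexUnits_injective.ne_iff]
    exact neg_one_ne_one
  have hΦ_inj : Function.Injective Φ := hz.injective_of_map_ne_one hG hΦz
  obtain ⟨n, hn⟩ := exists_range_eq_C hK φ
  have hrange : Φ.range = Q (n + 1) := h.range_eq_Q ⟨_, hφb⟩ hn hΦ hΦy
  refine ⟨n + 1, le_add_self, ?_,
    ⟨(MonoidHom.ofInjective hΦ_inj).trans (MulEquiv.subgroupCongr hrange)⟩⟩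
  rw [← h.infinite_subgroup_iff, infinite_iff_of_range_eq_C hφ hn]
  simp

end IsGeneralizedDicyclic

end TwoGroups

theorem theorem1 {G : Type*} [Group G] (hG : IsPGroup 2 G)
    (hU : ∃! H : Subgroup G, Nat.card H = 2) :
    ∃ n : ℕ∞, 1 ≤ n ∧ (n = ⊤ ↔ Infinite G) ∧
      (Nonempty (G ≃* TwoGroups.C n) ∨ Nonempty (G ≃* TwoGroups.Q n)) := by
  obtain ⟨z, hz⟩ := TwoGroups.exists_isUniqueInvolution hU
  by_cases hcomm : IsMulCommutative G
  · obtain ⟨n, hn, hinf, e⟩ := hz.exists_mulEquiv_C hG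
    exact ⟨n, hn, hinf, Or.inl e⟩
  · obtain ⟨K, y, h, b, hbK, hb⟩ := hz.exists_isGeneralizedDicyclic hG hcomm
    obtain ⟨n, hn, hinf, e⟩ := h.exists_mulEquiv_Q hz hG hbK hb
    exact ⟨n, hn, hinf, Or.inr e⟩
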